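/- For $a,C,k\in\mathbb N$ consider the signature consisting of the constructors $\mathsf s$ (unary) and $\mathsf 0$ (constant), the $(a+1)$-ary symbols $\mathsf g_0,\dots,\mathsf g_k$, the unary symbols $\mathsf{size}$, $\mathsf d_a$, $\mathsf g$ and the constants $\mathsf c$, $\mathsf z$. Put $M_i^0(x,x_1,\dots,x_a)=\mathsf g_i(x,x_1,\dots,x_a)$ and $M_i^{j+1}(x,x_1,\dots,x_a)=\mathsf g_i(x,M_i^j(x,x_1,\dots,x_a),\dots,M_i^j(x,x_1,\dots,x_a))$. Let $f:\mathbb N\to\mathbb N$, and let $\mathcal R'$ be a set of rewrite rules over the constructors $\mathsf s,\mathsf 0$ and further symbols (distinct from all symbols above), among them a unary symbol $\mathsf f$, such that $\mathsf f(\mathsf s^n(\mathsf 0))$ rewrites under $\mathcal R'$ to the normal form $\mathsf s^{f(n)}(\mathsf 0)$ for every $n$, and such that no left-hand side of a rule of $\mathcal R'$ has root $\mathsf s$ or $\mathsf 0$. The simulating system $\mathcal R_{\mathrm{sim}}=\mathcal R_{\mathrm{sim}}(a,C,k,\mathcal R')$ consists of $\mathcal R'$ and the rules (for $0\le i\le k$,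 $1\le i'\le k$, $1\le j\le a$) \begin{align*} \mathsf g_i(\mathsf s(x),x_1,\dots,x_a)&\to M_i^C(x,x_1,\dots,x_a)\\ \mathsf g_{i'}(x,x_1,\dots,x_a)&\to \mathsf g_{i'-1}(\mathsf f(\mathsf{size}(\mathsf g_0(\mathsf 0,x_1,\dots,x_a))),x_1,\dots,x_a)\\ \mathsf{size}(\mathsf g_i(x,x_1,\dots,x_a))&\to \mathsf d_a(\mathsf{size}(x_j))\\ \mathsf{size}(\mathsf c)&\to\mathsf s(\mathsf 0)\\ \mathsf d_a(\mathsf s(x))&\to\mathsf s^a(\mathsf d_a(x))\\ \mathsf d_a(\mathsf 0)&\to\mathsf 0\\ \mathsf g_0(x,x_1,\dots,x_a)&\to\mathsf c\\ \mathsf g_i(x,x_1,\dots,x_a)&\to x_j\\ \mathsf g(x)&\to\mathsf g_k(\mathsf f(\mathsf{size}(\mathsf g_0(\mathsf 0,x,\dots,x))),x,\dots,x)\\ \mathsf z&\to\mathsf g_k(\mathsf f(\mathsf{size}(\mathsf g_0(\mathsf 0,\mathsf c,\dots,\mathsf c))),\mathsf c,\dots,\mathsf c). \end{align*} **Proposition.**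 For every $f:\mathbb N\to\mathbb N$ there is such a system $\mathcal R'$, which can be chosen finite if $f$ is primitive recursive, such that for all $a,C,k\in\mathbb N$ the following holds. There is a well-founded monotone algebra $\mathcal I$ with carrier $\mathbb N$ and the usual order $>$ (that is, every interpretation function is strictly monotone in every argument) which is compatible with $\mathcal R_{\mathrm{sim}}$ (for each rule $l\to r$ and each assignment the value of $l$ is greater than that of $r$), and all interpretation functions of $\mathcal I$ are primitive recursive in $f$, i.e. lie in the smallest class of functions that contains $f$, the zero functions, the successor and the projections and is closed under composition and primitive recursion. More precisely, there are $d\ge\max\{C+2,a+1\}$, $\ell\in\mathbb N$ and a function $F_0$, primitive recursive in $f$ and equal to $F_0(m)=d^{m+1}$ if $f$ is primitive recursive, such that with $F_{n+1}(m)=F_n^{m+1}(m)$ (iteration) one has $$\mathsf f_{\mathcal I}(x)=F_\ell(x),\qquad (\mathsf g_i)_{\mathcal I}(x,x_1,\dots,x_a)=F_{\ell+2i}^{\,d^{x+1}(C+1)}(x+x_1+\dots+x_a)\quad(0\le i\le k).$$ In particular $\mathcal R_{\mathrm{sim}}$ is terminating. -/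

import Mathlib

open scoped FirstOrder

namespace SimTRS

/-! ### Term rewriting

A signature is a Mathlib first-order language (only its function symbols matter), terms over the
countably infinite set of variables `ℕ` are `L.Term ℕ`, an algebra with carrier `A` is an
`L.Structure A`, and `Term.realize` is evaluation under an assignment. -/

/-- A set of pairs `(l, r)`, read as rules `l → r`. -/
abbrev Rules (L : FirstOrder.Language.{0, 0}) : Type := Set (L.Term ℕ × L.Term ℕ)

/-- The two conditions on rewrite rules: no left-hand side is a variable, and every variable
of a right-hand side occurs in the left-hand side. -/
def IsTRS {L : FirstOrder.Language.{0, 0}} (R : Rules L) : Prop :=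
  ∀ p ∈ R, (∀ x : ℕ, p.1 ≠ FirstOrder.Language.Term.var x) ∧ p.2.varFinset ⊆ p.1.varFinset

/-- The one-step rewrite relation: the closure of the rules under substitutions and contexts. -/
inductive Step {L : FirstOrder.Language.{0, 0}} (R : Rules L) : L.Term ℕ → L.Term ℕ → Prop
  | root {l r : L.Term ℕ} (h : (l, r) ∈ R) (σ : ℕ → L.Term ℕ) : Step R (l.subst σ) (r.subst σ)
  | arg {n : ℕ} (g : L.Functions n) (ts : Fin n → L.Term ℕ) (i : Fin n) (u : L.Term ℕ)
      (h : Step R (ts i) u) :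
      Step R (FirstOrder.Language.Term.func g ts)
        (FirstOrder.Language.Term.func g (Function.update ts i u))

/-- There is no infinite rewrite sequence. -/
def Terminating {L : FirstOrder.Language.{0, 0}} (R : Rules L) : Prop :=
  ¬ ∃ t : ℕ → L.Term ℕ, ∀ i, Step R (t i) (t (i + 1))

/-- `s →! t`: the term `s` rewrites in finitely many steps to the normal form `t`. -/
def NormalizesTo {L : FirstOrder.Language.{0, 0}} (R : Rules L) (s t : L.Term ℕ) : Prop :=
  Relation.ReflTransGen (Step R) s t ∧ ∀ u, ¬ Step R t u

/-- A well-founded monotone algebra `(A, ≻)`: the relation `≻` is a well-founded proper order and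
every interpretation function is strictly monotone in each of its arguments. -/
structure IsWellFoundedMonotone {L : FirstOrder.Language.{0, 0}} {A : Type} (I : L.Structure A)
    (gt : A → A → Prop) : Prop where
  irrefl : ∀ x, ¬ gt x x
  trans : ∀ x y z, gt x y → gt y z → gt x z
  wf : WellFounded (fun x y => gt y x)
  mono : ∀ (n : ℕ) (g : L.Functions n) (xs : Fin n → A) (i : Fin n) (y : A),
    gt y (xs i) → gt (I.funMap g (Function.update xs i y)) (I.funMap g xs)

/-- The algebra orients every rule strictly, under every assignment. -/
def Compatible {L : FirstOrder.Language.{0, 0}} {A : Type} (I : L.Structure A) (gt : A → A → Prop)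
    (R : Rules L) : Prop :=
  ∀ p ∈ R, ∀ α : ℕ → A, gt (p.1.realize α) (p.2.realize α)

/-! ### Primitive recursion relative to a function -/

/-- The functions that are primitive recursive in `f`: the smallest class of number-theoretic
functions that contains the initial functions and `f` and is closed under composition and
primitive recursion. -/
inductive PrimrecIn (f : ℕ → ℕ) : ∀ {n : ℕ}, ((Fin n → ℕ) → ℕ) → Prop
  | oracle : PrimrecIn f (fun v : Fin 1 → ℕ => f (v 0))
  | zero (n : ℕ) : PrimrecIn f (fun _ : Fin n → ℕ => 0)
  | succ : PrimrecIn f (fun v : Fin 1 → ℕ => v 0 + 1)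
  | proj {n : ℕ} (i : Fin n) : PrimrecIn f (fun v : Fin n → ℕ => v i)
  | comp {m n : ℕ} {g : (Fin m → ℕ) → ℕ} {h : Fin m → (Fin n → ℕ) → ℕ}
      (hg : PrimrecIn f g) (hh : ∀ i, PrimrecIn f (h i)) :
      PrimrecIn f (fun v : Fin n → ℕ => g (fun i => h i v))
  | prec {n : ℕ} {g : (Fin n → ℕ) → ℕ} {h : (Fin (n + 2) → ℕ) → ℕ}
      (hg : PrimrecIn f g) (hh : PrimrecIn f h) :
      PrimrecIn f (fun v : Fin (n + 1) → ℕ =>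
        Nat.rec (motive := fun _ => ℕ) (g (Fin.tail v))
          (fun y r => h (Fin.cons r (Fin.cons y (Fin.tail v)))) (v 0))

/-- The fast-growing hierarchy over a base function:
`F 0 = b` and `F (n + 1) m = (F n)^(m + 1) m`. -/
def fast (b : ℕ → ℕ) : ℕ → ℕ → ℕ
  | 0 => b
  | n + 1 => fun m => (fast b n)^[m + 1] m

/-! ### Signatures -/

/-- The constructors for numerals. -/
inductive NumFun : ℕ → Type
  | zero : NumFun 0
  | succ : NumFun 1

/-- The signature of the numeral constructors. -/
def numLang : FirstOrder.Language.{0, 0} := ⟨NumFun, fun _ => Empty⟩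

/-- The signature of the rules for the parameter function: the numeral constructors and,
disjoint from them, the symbols of `G`. -/
abbrev baseLang (G : FirstOrder.Language.{0, 0}) : FirstOrder.Language.{0, 0} := numLang.sum G

/-- The other symbols of the simulating system: `g_0, …, g_k` of arity `a + 1`, the unary `size`,
`d_a` and `g`, and the constants `c` and `z`. -/
inductive SimFun (a k : ℕ) : ℕ → Type
  | gi (i : Fin (k + 1)) : SimFun a k (a + 1)
  | size : SimFun a k 1
  | d : SimFun a k 1
  | g : SimFun a k 1
  | c : SimFun a k 0
  | z : SimFun a k 0

/-- The signature with function symbols `SimFun a k`. -/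
def ownLang (a k : ℕ) : FirstOrder.Language.{0, 0} := ⟨SimFun a k, fun _ => Empty⟩

/-- The signature of the simulating system: a disjoint union. -/
abbrev simLang (G : FirstOrder.Language.{0, 0}) (a k : ℕ) : FirstOrder.Language.{0, 0} :=
  (baseLang G).sum (ownLang a k)

/-- The symbol `g_i` in the signature of the simulating system. -/
abbrev giSym (G : FirstOrder.Language.{0, 0}) (a k : ℕ) (i : Fin (k + 1)) :
    (simLang G a k).Functions (a + 1) := Sum.inr (SimFun.gi i)

/-- A symbol of `G` in the signature of the simulating system. -/
abbrev extSym {G : FirstOrder.Language.{0, 0}} (a k : ℕ) {n : ℕ} (h : G.Functions n) :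
    (simLang G a k).Functions n := Sum.inl (Sum.inr h)

/-! ### Rules that define the parameter function -/

/-- The numeral `s^n(0)`. -/
def numeral (G : FirstOrder.Language.{0, 0}) : ℕ → (baseLang G).Term ℕ
  | 0 => FirstOrder.Language.Term.func (Sum.inl NumFun.zero) ![]
  | n + 1 => FirstOrder.Language.Term.func (Sum.inl NumFun.succ) ![numeral G n]

/-- The rules `R` define the function `f` through the unary symbol `F`: they are rewrite rules,
the symbols `s` and `0` are constructors (every left-hand side has a root symbol from `G`), and
`F(s^n(0)) →! s^(f n)(0)` for all `n`. -/
structure Defines {G : FirstOrder.Language.{0, 0}} (R : Rules (baseLang G)) (F : G.Functions 1)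
    (f : ℕ → ℕ) : Prop where
  isTRS : IsTRS R
  root : ∀ p ∈ R, ∃ (n : ℕ) (h : G.Functions n) (ts : Fin n → (baseLang G).Term ℕ),
    p.1 = FirstOrder.Language.Term.func (Sum.inr h) ts
  eval : ∀ n, NormalizesTo R
    (FirstOrder.Language.Term.func (Sum.inr F) ![numeral G n]) (numeral G (f n))

/-! ### The simulating system -/

section Terms

variable (G : FirstOrder.Language.{0, 0}) (a k : ℕ)

/-- The constant `0`. -/
def tZero : (simLang G a k).Term ℕ := FirstOrder.Language.Term.func (Sum.inl (Sum.inl NumFun.zero)) ![]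

/-- The constant `c`. -/
def tC : (simLang G a k).Term ℕ := FirstOrder.Language.Term.func (Sum.inr SimFun.c) ![]

/-- The constant `z`. -/
def tZ : (simLang G a k).Term ℕ := FirstOrder.Language.Term.func (Sum.inr SimFun.z) ![]

variable {G a k}

/-- The term `s(t)`. -/
def tSucc (t : (simLang G a k).Term ℕ) : (simLang G a k).Term ℕ :=
  FirstOrder.Language.Term.func (Sum.inl (Sum.inl NumFun.succ)) ![t]

/-- The term `size(t)`. -/
def tSize (t : (simLang G a k).Term ℕ) : (simLang G a k).Term ℕ :=
  FirstOrder.Language.Term.func (Sum.inr SimFun.size) ![t]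

/-- The term `d_a(t)`. -/
def tD (t : (simLang G a k).Term ℕ) : (simLang G a k).Term ℕ :=
  FirstOrder.Language.Term.func (Sum.inr SimFun.d) ![t]

/-- The term `g(t)`. -/
def tG (t : (simLang G a k).Term ℕ) : (simLang G a k).Term ℕ :=
  FirstOrder.Language.Term.func (Sum.inr SimFun.g) ![t]

/-- The term `h(t)` for a unary symbol `h` of `G`. -/
def tExt (h : G.Functions 1) (t : (simLang G a k).Term ℕ) : (simLang G a k).Term ℕ :=
  FirstOrder.Language.Term.func (extSym a k h) ![t]

/-- The term `g_i(t, t_1, …, t_a)`. -/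
def tGi (i : Fin (k + 1)) (t : (simLang G a k).Term ℕ) (ts : Fin a → (simLang G a k).Term ℕ) :
    (simLang G a k).Term ℕ :=
  FirstOrder.Language.Term.func (giSym G a k i) (Fin.cons t ts)

/-- The term `M_i^j(t, t_1, …, t_a)`. -/
def tM (i : Fin (k + 1)) (t : (simLang G a k).Term ℕ) (ts : Fin a → (simLang G a k).Term ℕ) :
    ℕ → (simLang G a k).Term ℕ
  | 0 => tGi i t ts
  | j + 1 => tGi i t (fun _ => tM i t ts j)

end Terms

/-- The variable `x`. -/
def vx (G : FirstOrder.Language.{0, 0}) (a k : ℕ) : (simLang G a k).Term ℕ := FirstOrder.Language.Term.var 0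

/-- The variables `x_1, …, x_a`. -/
def vxs (G : FirstOrder.Language.{0, 0}) (a k : ℕ) : Fin a → (simLang G a k).Term ℕ :=
  fun j => FirstOrder.Language.Term.var ((j : ℕ) + 1)

/-- The rules of the simulating system, apart from those that define the unary symbol `F`. -/
inductive OwnRule (G : FirstOrder.Language.{0, 0}) (F : G.Functions 1) (a C k : ℕ) :
    (simLang G a k).Term ℕ × (simLang G a k).Term ℕ → Prop
  | r1 (i : Fin (k + 1)) : OwnRule G F a C k
      (tGi i (tSucc (vx G a k)) (vxs G a k), tM i (vx G a k) (vxs G a k) C)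
  | r2 (i : Fin k) : OwnRule G F a C k
      (tGi i.succ (vx G a k) (vxs G a k),
        tGi i.castSucc (tExt F (tSize (tGi 0 (tZero G a k) (vxs G a k)))) (vxs G a k))
  | r3 (i : Fin (k + 1)) (j : Fin a) : OwnRule G F a C k
      (tSize (tGi i (vx G a k) (vxs G a k)), tD (tSize (vxs G a k j)))
  | r4 : OwnRule G F a C k (tSize (tC G a k), tSucc (tZero G a k))
  | r5 : OwnRule G F a C k (tD (tSucc (vx G a k)), tSucc^[a] (tD (vx G a k)))
  | r6 : OwnRule G F a C k (tD (tZero G a k), tZero G a k)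
  | r7 : OwnRule G F a C k (tGi 0 (vx G a k) (vxs G a k), tC G a k)
  | r8 (i : Fin (k + 1)) (j : Fin a) : OwnRule G F a C k
      (tGi i (vx G a k) (vxs G a k), vxs G a k j)
  | r9 : OwnRule G F a C k
      (tG (vx G a k),
        tGi (Fin.last k) (tExt F (tSize (tGi 0 (tZero G a k) (fun _ => vx G a k))))
          (fun _ => vx G a k))
  | r10 : OwnRule G F a C k
      (tZ G a k,
        tGi (Fin.last k) (tExt F (tSize (tGi 0 (tZero G a k) (fun _ => tC G a k))))
          (fun _ => tC G a k))

/-- The simulating system: its own rules together with the rules `R` that define the symbol `F`,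
the latter transported along the inclusion of signatures. -/
def simRules {G : FirstOrder.Language.{0, 0}} (R : Rules (baseLang G)) (F : G.Functions 1) (a C k : ℕ) :
    Rules (simLang G a k) :=
  {p | OwnRule G F a C k p} ∪
    (fun p => ((FirstOrder.Language.LHom.sumInl : baseLang G →ᴸ simLang G a k).onTerm p.1,
      (FirstOrder.Language.LHom.sumInl : baseLang G →ᴸ simLang G a k).onTerm p.2)) '' R

end SimTRS

namespace SimTRS

/-! ### Closure properties of relative primitive recursion -/

namespace PrimrecIn

variable {f : ℕ → ℕ} {n : ℕ}

/-! Strict monotone interpretations prove termination once every rule decreases, so everything rests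
on the choice of functions. All levels `F_n` of the hierarchy are strictly increasing and dominate
`m ↦ d ^ (m + 1)` (`Steep`), so one application absorbs any multiplication by a factor up to `d`.

Two inequalities carry the system. The term `M_i^C` nests `g_i` boundedly often: this costs about `C
+ 1` times the number of iterations of `F_{l+2i}` used by one `g_i`, and replacing `x` by `x + 1`
multiplies that number by `d ≥ C + 2` (`iterated_lt_giInterp`). A call of the next lower `g_i` feeds
it a counter bounded by a fixed number of iterates of its own level; even an exponential in that
counter is one diagonalisation, and two levels up there is room for it (`callInterp_lt_giInterp`).

It remains to define `f` by rules oriented by some `F_l`. If `f` is primitive recursive, its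
defining equations are finitely many rules with strictly monotone primitive recursive
interpretations, and Ackermann's bound yields a level `l` above them. Otherwise a table of values
serves as the rules, and the bound needed is built into `F_0` (`exists_defines`,
`exists_fast_bound`). -/

theorem of_eq {g h : (Fin n → ℕ) → ℕ} (hg : PrimrecIn f g) (H : ∀ v, g v = h v) :
    PrimrecIn f h :=
  (funext H : g = h) ▸ hg

theorem comp₁ {g : ℕ → ℕ} {h : (Fin n → ℕ) → ℕ} (hg : PrimrecIn f fun v : Fin 1 → ℕ => g (v 0))
    (hh : PrimrecIn f h) : PrimrecIn f fun v => g (h v) :=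
  comp (m := 1) (h := fun _ => h) hg fun _ => hh

/-- In `hs`, coordinate 0 carries the previous value and coordinate 1 the counter; the two tails
strip both. -/
theorem natRec {idx base : (Fin n → ℕ) → ℕ} {step : ℕ → ℕ → (Fin n → ℕ) → ℕ}
    (hi : PrimrecIn f idx) (hb : PrimrecIn f base)
    (hs : PrimrecIn f fun v : Fin (n + 2) → ℕ => step (v 0) (v 1) (Fin.tail (Fin.tail v))) :
    PrimrecIn f fun v => Nat.rec (motive := fun _ => ℕ) (base v) (fun y r => step r y v) (idx v) :=
  (comp (m := n + 1) (h := Fin.cons idx fun i v => v i) (prec hb hs)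
    (Fin.cases hi fun i => proj i)).of_eq fun v => by
      simp only [Fin.cons_zero]
      congr 1

theorem tail_proj (i : Fin n) : PrimrecIn f fun v : Fin (n + 2) → ℕ => Fin.tail (Fin.tail v) i :=
  proj i.succ.succ

theorem comp_tail_tail {g : (Fin n → ℕ) → ℕ} (hg : PrimrecIn f g) :
    PrimrecIn f fun v : Fin (n + 2) → ℕ => g (Fin.tail (Fin.tail v)) :=
  comp hg tail_proj

theorem succ' {g : (Fin n → ℕ) → ℕ} (hg : PrimrecIn f g) : PrimrecIn f fun v => g v + 1 :=
  comp₁ (g := fun x => x + 1) succ hg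

theorem const (c : ℕ) : PrimrecIn f fun _ : Fin n → ℕ => c := by
  induction c with
  | zero => exact zero n
  | succ c ih => exact ih.succ'

theorem iterate {F : ℕ → ℕ} {idx g : (Fin n → ℕ) → ℕ}
    (hF : PrimrecIn f fun v : Fin 1 → ℕ => F (v 0)) (hi : PrimrecIn f idx) (hg : PrimrecIn f g) :
    PrimrecIn f fun v => F^[idx v] (g v) :=
  (natRec (step := fun r _ _ => F r) hi hg (comp₁ hF (proj 0))).of_eq fun v => by
    induction idx v with
    | zero => rfl
    | succ m ih => simp only [ih, Function.iterate_succ_apply']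

theorem add {g h : (Fin n → ℕ) → ℕ} (hg : PrimrecIn f g) (hh : PrimrecIn f h) :
    PrimrecIn f fun v => g v + h v :=
  (iterate (F := Nat.succ) succ hh hg).of_eq fun _ => Nat.succ_iterate _ _

theorem mul {g h : (Fin n → ℕ) → ℕ} (hg : PrimrecIn f g) (hh : PrimrecIn f h) :
    PrimrecIn f fun v => g v * h v :=
  (natRec (step := fun r _ v => r + g v) hh (zero n)
    (add (proj 0) hg.comp_tail_tail)).of_eq fun v => by
    induction h v with
    | zero => rfl
    | succ m ih => simp only [ih, Nat.mul_succ]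

theorem pow {g h : (Fin n → ℕ) → ℕ} (hg : PrimrecIn f g) (hh : PrimrecIn f h) :
    PrimrecIn f fun v => g v ^ h v :=
  (natRec (step := fun r _ v => r * g v) hh (const 1)
    (mul (proj 0) hg.comp_tail_tail)).of_eq fun v => by
    induction h v with
    | zero => rfl
    | succ m ih => simp only [ih, pow_succ]

theorem sum {m : ℕ} {g : Fin m → (Fin n → ℕ) → ℕ} (hg : ∀ i, PrimrecIn f (g i)) :
    PrimrecIn f fun v => ∑ i, g i v := by
  induction m with
  | zero => exact (zero n).of_eq fun v => by simp
  | succ m ih =>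
    exact ((hg 0).add (ih fun i => hg i.succ)).of_eq fun v => by rw [Fin.sum_univ_succ]

theorem sum_proj : PrimrecIn f fun v : Fin n → ℕ => ∑ i, v i := sum proj

theorem sum_range {g : ℕ → ℕ} (hg : PrimrecIn f fun v : Fin 1 → ℕ => g (v 0)) :
    PrimrecIn f fun v : Fin 1 → ℕ => ∑ i ∈ Finset.range (v 0), g i :=
  (natRec (step := fun r y _ => r + g y) (proj 0) (zero 1)
    (add (proj 0) (comp₁ hg (proj 1)))).of_eq fun v => by
    induction v 0 with
    | zero => rfl
    | succ m ih => simp only [ih, Finset.sum_range_succ]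

theorem fast {b : ℕ → ℕ} (hb : PrimrecIn f fun v : Fin 1 → ℕ => b (v 0)) (l : ℕ) :
    PrimrecIn f fun v : Fin 1 → ℕ => fast b l (v 0) := by
  induction l with
  | zero => exact hb
  | succ l ih => exact iterate ih (succ' (proj 0)) (proj 0)

/-- What is primitive recursive in a primitive recursive function is primitive recursive. -/
theorem primrec' {g : (Fin n → ℕ) → ℕ} (hg : PrimrecIn f g) (hf : Nat.Primrec f) :
    Nat.Primrec' fun v : List.Vector ℕ n => g v.get := by
  induction hg with
  | oracle =>
    exact (Nat.Primrec'.prim_iff₁.2 (Primrec.nat_iff.2 hf)).of_eq fun v =>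
      congrArg f (List.Vector.get_zero v).symm
  | zero n => exact Nat.Primrec'.const 0
  | succ => exact Nat.Primrec'.succ.of_eq fun v => congrArg Nat.succ (List.Vector.get_zero v).symm
  | proj i => exact Nat.Primrec'.get i
  | comp hg hh ihg ihh =>
    exact (Nat.Primrec'.comp _ ihg ihh).of_eq fun v => by
      congr 1; ext i; simp
  | @prec n g h hg hh ihg ihh =>
    -- `Nat.Primrec'.prec` passes the counter before the previous value, `PrimrecIn.prec` after it,
    -- so the first two arguments are swapped.
    have hsw : Nat.Primrec' fun w : List.Vector ℕ (n + 2) =>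
        h (Fin.cons (w.get 1) (Fin.cons (w.get 0) fun i => w.get i.succ.succ)) := by
      refine (Nat.Primrec'.comp (Fin.cons (fun w => w.get 1)
        (Fin.cons (fun w => w.get 0) fun i w => w.get i.succ.succ)) ihh ?_).of_eq fun v => ?_
      · refine Fin.cases (Nat.Primrec'.get 1) (Fin.cases (Nat.Primrec'.get 0) fun i => ?_)
        exact Nat.Primrec'.get i.succ.succ
      · congr 1
        ext i
        rw [List.Vector.get_ofFn]
        refine Fin.cases rfl (fun i => Fin.cases rfl (fun i => rfl) i) i
    refine (Nat.Primrec'.prec ihg hsw).of_eq fun v => ?_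
    obtain ⟨x, w, rfl⟩ := v.exists_eq_cons
    have ht : Fin.tail (x ::ᵥ w).get = w.get := by ext i; simp [Fin.tail]
    simp only [List.Vector.head_cons, List.Vector.tail_cons, List.Vector.get_cons_zero, ht]
    congr 1

theorem nat_primrec {g : ℕ → ℕ} (hg : PrimrecIn f fun v : Fin 1 → ℕ => g (v 0))
    (hf : Nat.Primrec f) : Nat.Primrec g :=
  Primrec.nat_iff.1 <| Nat.Primrec'.prim_iff₁.1 <| (hg.primrec' hf).of_eq fun v => by
    rw [List.Vector.get_zero]

end PrimrecIn

/-! ### The hierarchy over a strictly monotone base function of exponential growth -/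

section Fast

variable {b : ℕ → ℕ} {d : ℕ}

theorem mul_succ_le_pow (hd : 2 ≤ d) (m : ℕ) : d * (m + 1) ≤ d ^ (m + 1) := by
  rw [pow_succ']
  exact Nat.mul_le_mul_left d (Nat.lt_pow_self (by omega))

theorem add_two_le_pow (hd : 2 ≤ d) (m : ℕ) : m + 2 ≤ d ^ (m + 1) := by
  have := mul_succ_le_pow hd m
  nlinarith

/-- Strictly monotone functions that dominate `m ↦ d ^ (m + 1)`. -/
structure Steep (d : ℕ) (F : ℕ → ℕ) : Prop where
  strictMono : StrictMono F
  pow_le : ∀ m, d ^ (m + 1) ≤ F m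

namespace Steep

variable {F : ℕ → ℕ}

theorem add_two_le (hF : Steep d F) (hd : 2 ≤ d) (m : ℕ) : m + 2 ≤ F m :=
  (add_two_le_pow hd m).trans (hF.pow_le m)

theorem mul_succ_le (hF : Steep d F) (hd : 2 ≤ d) (m : ℕ) : d * (m + 1) ≤ F m :=
  (mul_succ_le_pow hd m).trans (hF.pow_le m)

theorem id_le (hF : Steep d F) (hd : 2 ≤ d) : id ≤ F := fun m => by
  have := hF.add_two_le hd m
  simp only [id]; omega

theorem iterate_le_iterate (hF : Steep d F) (hd : 2 ≤ d) {n n' m m' : ℕ} (hn : n ≤ n')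
    (hm : m ≤ m') : F^[n] m ≤ F^[n'] m' :=
  (Function.monotone_iterate_of_id_le (hF.id_le hd) hn m).trans
    ((hF.strictMono.monotone.iterate n') hm)

theorem iterate_lt_iterate (hF : Steep d F) (hd : 2 ≤ d) {n n' m m' : ℕ} (hn : n ≤ n')
    (hm : m < m') : F^[n] m < F^[n'] m' :=
  (Function.monotone_iterate_of_id_le (hF.id_le hd) hn m).trans_lt
    ((hF.strictMono.iterate n') hm)

theorem le_iterate_one (hF : Steep d F) (hd : 2 ≤ d) {n : ℕ} (hn : 1 ≤ n) (m : ℕ) :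
    F m ≤ F^[n] m :=
  hF.iterate_le_iterate hd (n := 1) hn le_rfl

end Steep

theorem Steep.fast (hb : Steep d b) (hd : 2 ≤ d) (n : ℕ) : Steep d (fast b n) := by
  induction n with
  | zero => exact hb
  | succ n ih =>
    refine ⟨fun m m' h => ih.iterate_lt_iterate hd (by omega) h, fun m => ?_⟩
    exact (ih.pow_le m).trans (ih.le_iterate_one hd (by omega) m)

theorem fast_le_fast (hb : Steep d b) (hd : 2 ≤ d) {n n' : ℕ} (h : n ≤ n') (m : ℕ) :
    fast b n m ≤ fast b n' m := by
  induction h with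
  | refl => exact le_rfl
  | @step p _ ih => exact ih.trans ((hb.fast hd p).le_iterate_one hd (by omega) m)

/-- `ack (n + 1) m` comes from iterating `ack n` `m + 1` times from 1, whereas the hierarchy
iterates from `m`; hence the restriction to `1 ≤ m`. -/
theorem ack_le_fast (hb : Steep d b) (hd : 2 ≤ d) (n : ℕ) {m : ℕ} (hm : 1 ≤ m) :
    ack n m ≤ fast b n m := by
  induction n generalizing m with
  | zero => have := hb.add_two_le hd m; simp only [ack_zero, SimTRS.fast]; omega
  | succ n ih =>
    have key : ∀ j, ack (n + 1) j ≤ (SimTRS.fast b n)^[j + 1] 1 := by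
      intro j
      induction j with
      | zero => simpa using ih le_rfl
      | succ j ihj =>
        rw [ack_succ_succ, Function.iterate_succ_apply']
        exact (ih (ack_pos _ _)).trans ((hb.fast hd n).strictMono.monotone ihj)
    exact (key m).trans ((hb.fast hd n).iterate_le_iterate hd le_rfl hm)

end Fast

open FirstOrder.Language (Term)

/-! ### General facts on rewriting -/

section Rewriting

variable {L : FirstOrder.Language.{0, 0}} {R : Rules L}

theorem reflTransGen_arg {n : ℕ} (g : L.Functions n) (ts : Fin n → L.Term ℕ) (i : Fin n)
    {u : L.Term ℕ} (h : Relation.ReflTransGen (Step R) (ts i) u) :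
    Relation.ReflTransGen (Step R) (.func g ts) (.func g (Function.update ts i u)) := by
  induction h with
  | refl => rw [Function.update_eq_self]
  | @tail u w _ hs ih =>
    refine ih.tail ?_
    have := Step.arg (R := R) g (Function.update ts i u) i w (by simpa using hs)
    simpa using this

theorem reflTransGen_func {n : ℕ} (g : L.Functions n) {ts us : Fin n → L.Term ℕ}
    (h : ∀ i, Relation.ReflTransGen (Step R) (ts i) (us i)) :
    Relation.ReflTransGen (Step R) (.func g ts) (.func g us) := by
  -- The arguments are rewritten one at a time; `s` collects the positions already done.
  have key : ∀ s : Finset (Fin n), Relation.ReflTransGen (Step R) (.func g ts)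
      (.func g fun i => if i ∈ s then us i else ts i) := by
    intro s
    induction s using Finset.induction_on with
    | empty => simpa using Relation.ReflTransGen.refl
    | insert i s hi ih =>
      have := reflTransGen_arg (R := R) g (fun j => if j ∈ s then us j else ts j) i
        (u := us i) (by simpa [hi] using h i)
      convert ih.trans this using 2
      ext j : 1
      by_cases hj : j = i <;> simp [hj]
  simpa using key Finset.univ

theorem isWellFoundedMonotone_of_strictMono {I : L.Structure ℕ}
    (h : ∀ (n : ℕ) (g : L.Functions n), StrictMono fun v : Fin n → ℕ => I.funMap g v) :
    IsWellFoundedMonotone I (fun x y : ℕ => x > y) where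
  irrefl := lt_irrefl
  trans _ _ _ hxy hyz := lt_trans hyz hxy
  wf := Nat.lt_wfRel.wf
  mono n g _ _ _ hy := h n g (lt_update_self_iff.2 hy)

/-- Substitutions are absorbed by changing the assignment, contexts by strict monotonicity. -/
theorem realize_lt_of_step {A : Type} {I : L.Structure A} {gt : A → A → Prop}
    (hI : IsWellFoundedMonotone I gt) (hR : Compatible I gt R) {s t : L.Term ℕ}
    (h : Step R s t) (α : ℕ → A) : gt (s.realize α) (t.realize α) := by
  induction h with
  | root h σ => simpa only [Term.realize_subst] using hR _ h _
  | @arg n g ts i u _ ih =>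
    convert hI.mono n g (fun j => (Function.update ts i u j).realize α) i ((ts i).realize α)
      (by simpa using ih) using 1
    · refine congrArg (I.funMap g) (funext fun j => ?_)
      by_cases hj : j = i
      · subst hj; simp
      · simp [hj]
    · rfl

theorem terminating_of_compatible {A : Type} [Inhabited A] {I : L.Structure A} {gt : A → A → Prop}
    (hI : IsWellFoundedMonotone I gt) (hR : Compatible I gt R) : Terminating R := by
  rintro ⟨t, ht⟩
  have hs := fun i => realize_lt_of_step hI hR (ht i) fun _ => default
  exact (wellFounded_iff_isEmpty_descending_chain.1 hI.wf).elim ⟨fun i => (t i).realize _, hs⟩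

theorem step_of_mem {l r s t : L.Term ℕ} (h : (l, r) ∈ R) (σ : ℕ → L.Term ℕ)
    (hs : l.subst σ = s) (ht : r.subst σ = t) : Step R s t :=
  hs ▸ ht ▸ Step.root h σ

theorem exists_subst {n : ℕ} (ts : Fin n → L.Term ℕ) :
    ∃ σ : ℕ → L.Term ℕ, ∀ i : Fin n, σ i = ts i :=
  ⟨fun k => if h : k < n then ts ⟨k, h⟩ else .var 0, fun i => by simp⟩

end Rewriting

theorem apply_cons {α β : Type} {n : ℕ} (g : α → β) (x : α) (ts : Fin n → α) :
    (fun i => g ((Fin.cons x ts : Fin (n + 1) → α) i)) = Fin.cons (g x) fun i => g (ts i) :=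
  funext (Fin.cases rfl fun _ => rfl)

/-! ### Numerals: normal forms and values -/

section Numerals

variable {G : FirstOrder.Language.{0, 0}}

/-- The term `s(t)` over the base signature. -/
def bSucc (t : (baseLang G).Term ℕ) : (baseLang G).Term ℕ := .func (Sum.inl NumFun.succ) ![t]

theorem subst_bSucc (t : (baseLang G).Term ℕ) (σ : ℕ → (baseLang G).Term ℕ) :
    (bSucc t).subst σ = bSucc (t.subst σ) := by
  refine congrArg (Term.func _) (funext fun i => ?_)
  fin_cases i; rfl

theorem subst_numeral (n : ℕ) (σ : ℕ → (baseLang G).Term ℕ) :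
    (numeral G n).subst σ = numeral G n := by
  induction n with
  | zero =>
    simp only [numeral, Term.subst]
    congr 1; ext i : 1; exact i.elim0
  | succ n ih =>
    simp only [numeral, Term.subst]
    congr 1; ext i : 1; fin_cases i; exact ih

theorem varFinset_numeral (n : ℕ) : (numeral G n).varFinset = ∅ := by
  induction n with
  | zero => simp [numeral]
  | succ n ih => simp [numeral, ih]

/-- Numerals are normal forms of rules whose left-hand sides are not rooted in a constructor. -/
theorem not_step_numeral {R : Rules (baseLang G)}
    (hR : ∀ p ∈ R, ∃ (n : ℕ) (h : G.Functions n) (ts : Fin n → (baseLang G).Term ℕ),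
      p.1 = Term.func (Sum.inr h) ts) (n : ℕ) (u : (baseLang G).Term ℕ) :
    ¬ Step R (numeral G n) u := by
  intro h
  generalize ht : numeral G n = t at h
  induction h generalizing n with
  | root h σ =>
    obtain ⟨m, s, ts, hl⟩ := hR _ h
    simp only at hl
    subst hl
    cases n <;> simp only [numeral, Term.subst] at ht <;> cases ht
  | arg g ts i u h ih =>
    cases n with
    | zero =>
      simp only [numeral] at ht
      cases ht
      exact i.elim0
    | succ n =>
      simp only [numeral] at ht
      cases ht
      refine ih n ?_
      fin_cases i; rfl

instance numStructure : numLang.Structure ℕ where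
  funMap
    | .zero, _ => 0
    | .succ, v => v 0 + 1
  RelMap r := r.elim

theorem realize_numeral [G.Structure ℕ] (n : ℕ) (α : ℕ → ℕ) : (numeral G n).realize α = n := by
  induction n with
  | zero => rfl
  | succ n ih =>
    change (numeral G n).realize α + 1 = _
    rw [ih]

theorem realize_bSucc [G.Structure ℕ] (t : (baseLang G).Term ℕ) (α : ℕ → ℕ) :
    (bSucc t).realize α = t.realize α + 1 := rfl

end Numerals

/-! ### Codes of primitive recursive functions -/

/-- Codes of primitive recursive functions, by arity. -/
inductive Code : ℕ → Type
  | zero : Code 0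
  | succ : Code 1
  | proj {n : ℕ} (i : Fin n) : Code n
  | comp {m n : ℕ} (g : Code m) (h : Fin m → Code n) : Code n
  | prec {n : ℕ} (g : Code n) (h : Code (n + 2)) : Code (n + 1)

namespace Code

/-- The function with a given code. -/
def eval : ∀ {n : ℕ}, Code n → (Fin n → ℕ) → ℕ
  | _, zero, _ => 0
  | _, succ, v => v 0 + 1
  | _, proj i, v => v i
  | _, comp g h, v => g.eval fun i => (h i).eval v
  | _, prec g h, v => Nat.rec (motive := fun _ => ℕ) (g.eval (Fin.tail v))
      (fun y r => h.eval (Fin.cons r (Fin.cons y (Fin.tail v)))) (v 0)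

/-- `Nat.Primrec'` is a proposition, so its derivations cannot serve as function symbols; codes are
the data that the signature needs. -/
theorem exists_eval_eq {n : ℕ} {g : List.Vector ℕ n → ℕ} (hg : Nat.Primrec' g) :
    ∃ c : Code n, ∀ v : List.Vector ℕ n, c.eval v.get = g v := by
  induction hg with
  | zero => exact ⟨zero, fun _ => rfl⟩
  | succ => exact ⟨succ, fun v => congrArg Nat.succ (List.Vector.get_zero v)⟩
  | get i => exact ⟨proj i, fun _ => rfl⟩
  | comp f _ _ ihg ihf =>
    obtain ⟨c, hc⟩ := ihg
    choose e he using ihf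
    refine ⟨comp c e, fun v => ?_⟩
    simp only [← hc, eval]
    congr 1
    ext i
    rw [he, List.Vector.get_ofFn]
  | @prec n f g _ _ ihf ihg =>
    obtain ⟨c, hc⟩ := ihf
    obtain ⟨e, he⟩ := ihg
    refine ⟨prec c (comp e (Fin.cons (proj 1) (Fin.cons (proj 0) fun i => proj i.succ.succ))),
      fun v => ?_⟩
    obtain ⟨x, w, rfl⟩ := v.exists_eq_cons
    have ht : Fin.tail (x ::ᵥ w).get = w.get := by ext i; simp [Fin.tail]
    simp only [eval, ht, List.Vector.get_cons_zero, List.Vector.head_cons, List.Vector.tail_cons]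
    induction x with
    | zero => exact hc w
    | succ x ih =>
      simp only [ih (by ext i; simp [Fin.tail])]
      rw [← he]
      congr 1
      ext i
      refine Fin.cases rfl (fun i => Fin.cases rfl (fun i => ?_) i) i
      simp [eval]

/-- A strictly monotone interpretation of the symbol of a code. -/
def interp : ∀ {n : ℕ}, Code n → (Fin n → ℕ) → ℕ
  | _, zero, _ => 1
  | _, succ, v => v 0 + 2
  | _, proj _, v => ∑ i, v i + 1
  | _, comp g h, v => g.interp (fun i => (h i).interp v) + ∑ i, v i + 1
  | _, prec g h, v => Nat.rec (motive := fun _ => ℕ) (g.interp (Fin.tail v) + 1)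
      (fun y r => h.interp (Fin.cons r (Fin.cons y (Fin.tail v))) + r + 1) (v 0)

theorem strictMono_sum (n : ℕ) : StrictMono fun v : Fin n → ℕ => ∑ i, v i :=
  fun _ _ h => Fintype.sum_strictMono h

theorem strictMono_of_cons {n : ℕ} {H : ℕ → (Fin n → ℕ) → ℕ} (h₁ : ∀ t, StrictMono fun y => H y t)
    (h₂ : ∀ y, StrictMono (H y)) : StrictMono fun v : Fin (n + 1) → ℕ => H (v 0) (Fin.tail v) := by
  intro v w hvw
  have hle : Fin.tail v ≤ Fin.tail w := fun i => hvw.le i.succ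
  rcases (hvw.le 0).lt_or_eq with h0 | h0
  · exact (h₁ _ h0).trans_le ((h₂ _).monotone hle)
  · have hne : Fin.tail v ≠ Fin.tail w := fun h => hvw.ne <| by
      rw [← Fin.cons_self_tail v, ← Fin.cons_self_tail w, h0, h]
    simpa only [h0] using h₂ (w 0) (lt_of_le_of_ne hle hne)

/-- The sums of all arguments in `interp` give strictness even where the coded function ignores an
argument; in a recursion the summand `r` does so for the counter. -/
theorem strictMono_interp {n : ℕ} (c : Code n) : StrictMono c.interp := by
  induction c with
  | zero => exact fun v w h => absurd (Subsingleton.elim v w) h.ne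
  | succ =>
    intro v w h
    have := strictMono_sum 1 h
    simp only [interp]
    simpa using this
  | proj i => exact fun v w h => Nat.succ_lt_succ (strictMono_sum _ h)
  | comp g h ihg ihh =>
    intro v w hvw
    have h₁ := ihg.monotone fun i => (ihh i).monotone hvw.le
    have h₂ := strictMono_sum _ hvw
    simp only [interp]
    simp only at h₂
    omega
  | prec g h ihg ihh =>
    refine strictMono_of_cons (H := fun y t => Nat.rec (motive := fun _ => ℕ) (g.interp t + 1)
      (fun y r => h.interp (Fin.cons r (Fin.cons y t)) + r + 1) y) ?_ ?_
    · refine fun t => strictMono_nat_of_lt_succ fun y => ?_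
      simp only
      omega
    · intro y t u htu
      induction y with
      | zero => exact Nat.succ_lt_succ (ihg htu)
      | succ y ih =>
        have := ihh.monotone (Fin.cons_le_cons.2 ⟨ih.le, Fin.cons_le_cons.2 ⟨le_refl y, htu.le⟩⟩)
        simp only at this ⊢ ih
        omega

theorem primrecIn_interp (f : ℕ → ℕ) {n : ℕ} (c : Code n) : PrimrecIn f c.interp := by
  induction c with
  | zero => exact .const 1
  | succ => exact (PrimrecIn.proj 0).succ'.succ'
  | proj i => exact PrimrecIn.sum_proj.succ'
  | comp g h ihg ihh => exact ((ihg.comp ihh).add .sum_proj).succ'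
  | prec g h ihg ihh => exact .prec ihg.succ' (ihh.add (.proj 0)).succ'

end Code

/-- The defined symbols: one for each code, and a further unary symbol. -/
inductive CodeFun : ℕ → Type
  | main : CodeFun 1
  | code {n : ℕ} (c : Code n) : CodeFun n

/-- The signature with function symbols `CodeFun`. -/
def codeLang : FirstOrder.Language.{0, 0} := ⟨CodeFun, fun _ => Empty⟩

/-- The interpretation of the defined symbols, with a given function for the main symbol. -/
abbrev codeStructure (φ : ℕ → ℕ) : codeLang.Structure ℕ where
  funMap
    | .main, v => φ (v 0)
    | .code c, v => c.interp v
  RelMap r := r.elim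

/-- The interpretation of the numerals and the defined symbols. -/
abbrev baseStructure (φ : ℕ → ℕ) : (baseLang codeLang).Structure ℕ :=
  letI := codeStructure φ
  inferInstance

/-- The term `c(t_1, …, t_n)` for a code `c`. -/
def app {n : ℕ} (c : Code n) (ts : Fin n → (baseLang codeLang).Term ℕ) :
    (baseLang codeLang).Term ℕ := .func (Sum.inr (CodeFun.code c)) ts

/-- The main symbol applied to a term. -/
def appMain (t : (baseLang codeLang).Term ℕ) : (baseLang codeLang).Term ℕ :=
  .func (Sum.inr CodeFun.main) ![t]

theorem subst_app {n : ℕ} (c : Code n) (ts : Fin n → (baseLang codeLang).Term ℕ)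
    (σ : ℕ → (baseLang codeLang).Term ℕ) : (app c ts).subst σ = app c fun i => (ts i).subst σ := rfl

/-- The variables with numbers `m, …, m + n - 1`. -/
def vars (m n : ℕ) : Fin n → (baseLang codeLang).Term ℕ := fun i => .var (i + m)

namespace Code

/-- The defining rules of a code and of all its subcodes. -/
def rules : ∀ {n : ℕ}, Code n → Rules (baseLang codeLang)
  | _, zero => {(app zero ![], numeral codeLang 0)}
  | _, succ => {(app succ (vars 0 1), bSucc (.var 0))}
  | n, proj i => {(app (proj i) (vars 0 n), vars 0 n i)}
  | n, comp g h => {(app (comp g h) (vars 0 n), app g fun i => app (h i) (vars 0 n))} ∪ g.rules ∪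
      ⋃ i, (h i).rules
  | _, @prec n g h => {(app (prec g h) (Fin.cons (numeral codeLang 0) (vars 1 n)), app g (vars 1 n)),
      (app (prec g h) (Fin.cons (bSucc (.var 0)) (vars 1 n)),
        app h (Fin.cons (app (prec g h) (Fin.cons (.var 0) (vars 1 n)))
          (Fin.cons (.var 0) (vars 1 n))))} ∪ g.rules ∪ h.rules

theorem finite_rules {n : ℕ} (c : Code n) : c.rules.Finite := by
  induction c with
  | zero | succ | proj => exact Set.finite_singleton _
  | comp g h ihg ihh => exact ((Set.finite_singleton _).union ihg).union (Set.finite_iUnion ihh)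
  | prec g h ihg ihh => exact ((Set.toFinite _).union ihg).union ihh

/-- A property of rules that holds for the defining rules of each code holds for all rules. -/
theorem forall_rules {P : (baseLang codeLang).Term ℕ × (baseLang codeLang).Term ℕ → Prop}
    (h_zero : P (app zero ![], numeral codeLang 0))
    (h_succ : P (app succ (vars 0 1), bSucc (.var 0)))
    (h_proj : ∀ {n : ℕ} (i : Fin n), P (app (proj i) (vars 0 n), vars 0 n i))
    (h_comp : ∀ {m n : ℕ} (g : Code m) (h : Fin m → Code n),
      P (app (comp g h) (vars 0 n), app g fun i => app (h i) (vars 0 n)))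
    (h_prec_zero : ∀ {n : ℕ} (g : Code n) (h : Code (n + 2)),
      P (app (prec g h) (Fin.cons (numeral codeLang 0) (vars 1 n)), app g (vars 1 n)))
    (h_prec_succ : ∀ {n : ℕ} (g : Code n) (h : Code (n + 2)),
      P (app (prec g h) (Fin.cons (bSucc (.var 0)) (vars 1 n)),
        app h (Fin.cons (app (prec g h) (Fin.cons (.var 0) (vars 1 n)))
          (Fin.cons (.var 0) (vars 1 n)))))
    {n : ℕ} (c : Code n) : ∀ p ∈ c.rules, P p := by
  induction c with
  | zero => rintro _ rfl; exact h_zero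
  | succ => rintro _ rfl; exact h_succ
  | proj i => rintro _ rfl; exact h_proj i
  | comp g h ihg ihh =>
    rintro p ((rfl | hp) | hp)
    · exact h_comp g h
    · exact ihg p hp
    · obtain ⟨i, hi⟩ := Set.mem_iUnion.1 hp
      exact ihh i p hi
  | prec g h ihg ihh =>
    rintro p (((rfl | rfl) | hp) | hp)
    · exact h_prec_zero g h
    · exact h_prec_succ g h
    · exact ihg p hp
    · exact ihh p hp

theorem isTRS_rules {n : ℕ} (c : Code n) : IsTRS c.rules := by
  refine forall_rules (P := fun p => (∀ x : ℕ, p.1 ≠ .var x) ∧ p.2.varFinset ⊆ p.1.varFinset)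
    ?_ ?_ ?_ ?_ ?_ ?_ c <;> intros <;> refine ⟨fun x => by simp [app], ?_⟩
  · simp [varFinset_numeral]
  · simp [app, bSucc, vars]
  · exact Finset.subset_biUnion_of_mem (fun i => (vars 0 _ i).varFinset) (Finset.mem_univ _)
  · simp [app]
  · simp only [app, Term.varFinset, Finset.subset_iff, Finset.mem_biUnion, Finset.mem_univ,
      true_and, Fin.exists_fin_succ, Fin.cons_succ]
    exact fun _ => Or.inr
  · simp [app, bSucc, Finset.subset_iff, Fin.exists_fin_succ]

theorem root_rules {n : ℕ} (c : Code n) : ∀ p ∈ c.rules, ∃ (n : ℕ) (h : codeLang.Functions n)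
    (ts : Fin n → (baseLang codeLang).Term ℕ), p.1 = Term.func (Sum.inr h) ts := by
  refine forall_rules ?_ ?_ ?_ ?_ ?_ ?_ c <;> intros <;> exact ⟨_, _, _, rfl⟩

/-- Any `φ` will do, since the main symbol does not occur in the rules of a code. Each
interpretation exceeds that of the right-hand side by construction. -/
theorem compatible_rules (φ : ℕ → ℕ) {n : ℕ} (c : Code n) :
    Compatible (baseStructure φ) (fun x y : ℕ => x > y) c.rules := by
  let _ := codeStructure φ
  have happ : ∀ {n : ℕ} (c : Code n) (ts : Fin n → (baseLang codeLang).Term ℕ) (α : ℕ → ℕ),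
      (app c ts).realize α = c.interp fun i => (ts i).realize α := fun _ _ _ => rfl
  refine forall_rules (P := fun p => ∀ α : ℕ → ℕ, p.1.realize α > p.2.realize α)
    ?_ ?_ ?_ ?_ ?_ ?_ c
  · intro α
    simp [happ, realize_numeral, interp]
  · intro α
    simp [happ, realize_bSucc, interp, vars]
  · intro n i α
    simp only [happ, interp]
    have := Finset.single_le_sum (f := fun i => (vars 0 n i).realize α) (fun _ _ => Nat.zero_le _)
      (Finset.mem_univ i)
    omega
  · intro m n g h α
    simp only [happ, interp]
    omega
  · intro n g h α
    simp only [happ, interp, Fin.cons_zero, realize_numeral]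
    exact Nat.lt_succ_self _
  · intro n g h α
    simp only [happ, apply_cons fun t : (baseLang codeLang).Term ℕ => t.realize α, interp,
      Fin.cons_zero, Fin.tail_cons, realize_bSucc, Term.realize_var]
    omega

theorem reflTransGen_app {R : Rules (baseLang codeLang)} {n : ℕ} (c : Code n) (hc : c.rules ⊆ R)
    (v : Fin n → ℕ) : Relation.ReflTransGen (Step R) (app c fun i => numeral codeLang (v i))
      (numeral codeLang (c.eval v)) := by
  induction c with
  | zero =>
    refine .single (step_of_mem (hc rfl) (fun _ => .var 0) ?_ (subst_numeral _ _))
    exact congrArg (app zero) (Subsingleton.elim _ _)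
  | succ =>
    refine .single (step_of_mem (hc rfl) (fun _ => numeral codeLang (v 0)) ?_ ?_)
    · refine congrArg (app succ) (funext fun i => ?_)
      fin_cases i; rfl
    · refine congrArg (Term.func _) (funext fun i => ?_)
      fin_cases i; rfl
  | proj i =>
    obtain ⟨σ, hσ⟩ := exists_subst fun i => numeral codeLang (v i)
    exact .single (step_of_mem (hc rfl) σ (congrArg (app (proj i)) (funext hσ)) (hσ i))
  | comp g h ihg ihh =>
    obtain ⟨σ, hσ⟩ := exists_subst fun i => numeral codeLang (v i)
    refine .trans (.single (step_of_mem (hc (Or.inl (Or.inl rfl))) σ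
      (congrArg (app (comp g h)) (funext hσ)) rfl)) ?_
    refine .trans ?_ (ihg (fun p hp => hc (Or.inl (Or.inr hp))) _)
    refine reflTransGen_func _ fun i => ?_
    have := ihh i (fun p hp => hc (Or.inr (Set.mem_iUnion.2 ⟨i, hp⟩))) v
    rwa [← funext hσ] at this
  | @prec n g h ihg ihh =>
    obtain ⟨y, t, rfl⟩ : ∃ (y : ℕ) (t : Fin n → ℕ), v = Fin.cons y t :=
      ⟨v 0, Fin.tail v, (Fin.cons_self_tail v).symm⟩
    rw [apply_cons]
    simp only [eval, Fin.tail_cons, Fin.cons_zero]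
    induction y with
    | zero =>
      obtain ⟨σ, hσ⟩ := exists_subst
        (Fin.cons (numeral codeLang 0) fun i => numeral codeLang (t i))
      refine .trans (.single (step_of_mem (hc (Or.inl (Or.inl (Or.inl rfl)))) σ ?_ ?_))
        (ihg (fun p hp => hc (Or.inl (Or.inr hp))) t)
      · refine congrArg (app (prec g h)) ?_
        rw [apply_cons fun t : (baseLang codeLang).Term ℕ => t.subst σ, subst_numeral]
        exact congrArg _ (funext fun i => hσ i.succ)
      · exact congrArg (app g) (funext fun i => hσ i.succ)
    | succ y ih =>
      obtain ⟨σ, hσ⟩ := exists_subst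
        (Fin.cons (numeral codeLang y) fun i => numeral codeLang (t i))
      have hv : (fun i => (vars 1 n i).subst σ) = fun i => numeral codeLang (t i) :=
        funext fun i => hσ i.succ
      have h0 : σ 0 = numeral codeLang y := hσ 0
      -- After the recursion rule, the inner call is first normalised by `ih`; then `h` is applied
      -- to numerals only.
      have hrec := ihh (fun p hp => hc (Or.inr hp)) (Fin.cons (Nat.rec (motive := fun _ => ℕ)
        (g.eval t) (fun y r => h.eval (Fin.cons r (Fin.cons y t))) y) (Fin.cons y t))
      rw [apply_cons, apply_cons] at hrec
      refine .trans (.single (step_of_mem (hc (Or.inl (Or.inl (Or.inr rfl)))) σ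
        (t := app h (Fin.cons (app (prec g h) (Fin.cons (numeral codeLang y)
          fun i => numeral codeLang (t i)))
          (Fin.cons (numeral codeLang y) fun i => numeral codeLang (t i)))) ?_ ?_))
        (.trans (reflTransGen_func _ ?_) hrec)
      · simp only [subst_app, apply_cons fun t : (baseLang codeLang).Term ℕ => t.subst σ, hv,
          subst_bSucc, Term.subst, h0]
        rfl
      · simp only [subst_app, apply_cons fun t : (baseLang codeLang).Term ℕ => t.subst σ, hv,
          Term.subst, h0]
      · exact Fin.cases ih fun i => .refl

end Code

/-! ### Rules for a given function -/

theorem realize_appMain (φ : ℕ → ℕ) (t : (baseLang codeLang).Term ℕ) (α : ℕ → ℕ) :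
    letI := codeStructure φ
    (appMain t).realize α = φ (t.realize α) := rfl

theorem subst_appMain (t : (baseLang codeLang).Term ℕ) (σ : ℕ → (baseLang codeLang).Term ℕ) :
    (appMain t).subst σ = appMain (t.subst σ) := by
  refine congrArg (Term.func _) (funext fun i => ?_)
  fin_cases i; rfl

/-- The rules that list all values of a function. -/
def tableRules (f : ℕ → ℕ) : Rules (baseLang codeLang) :=
  Set.range fun n => (appMain (numeral codeLang n), numeral codeLang (f n))

theorem defines_tableRules (f : ℕ → ℕ) : Defines (tableRules f) CodeFun.main f := by
  have hroot : ∀ p ∈ tableRules f, ∃ (n : ℕ) (h : codeLang.Functions n)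
      (ts : Fin n → (baseLang codeLang).Term ℕ), p.1 = Term.func (Sum.inr h) ts := by
    rintro _ ⟨n, rfl⟩
    exact ⟨_, _, _, rfl⟩
  refine ⟨?_, hroot, fun n => ⟨.single ?_, not_step_numeral hroot _⟩⟩
  · rintro _ ⟨n, rfl⟩
    exact ⟨fun x => by simp [appMain], by simp [varFinset_numeral]⟩
  · refine step_of_mem ⟨n, rfl⟩ (fun _ => .var 0) ?_ (subst_numeral _ _)
    rw [subst_appMain, subst_numeral]
    rfl

/-- The rules for the main symbol by cases on the argument, for positive arguments by means of
the function with code `c`. -/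
def codeRules (m : ℕ) (c : Code 1) : Rules (baseLang codeLang) :=
  {(appMain (numeral codeLang 0), numeral codeLang m),
    (appMain (bSucc (.var 0)), app c (vars 0 1))} ∪ c.rules

theorem finite_codeRules (m : ℕ) (c : Code 1) : (codeRules m c).Finite :=
  (Set.toFinite _).union c.finite_rules

theorem defines_codeRules {f : ℕ → ℕ} {c : Code 1} (hc : ∀ v, c.eval v = f (v 0 + 1)) :
    Defines (codeRules (f 0) c) CodeFun.main f := by
  have hroot : ∀ p ∈ codeRules (f 0) c, ∃ (n : ℕ) (h : codeLang.Functions n)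
      (ts : Fin n → (baseLang codeLang).Term ℕ), p.1 = Term.func (Sum.inr h) ts := by
    rintro p ((rfl | rfl) | hp)
    · exact ⟨_, _, _, rfl⟩
    · exact ⟨_, _, _, rfl⟩
    · exact c.root_rules p hp
  refine ⟨?_, hroot, fun n => ⟨?_, not_step_numeral hroot _⟩⟩
  · rintro p ((rfl | rfl) | hp)
    · exact ⟨fun x => by simp [appMain], by simp [varFinset_numeral]⟩
    · exact ⟨fun x => by simp [appMain], by simp [appMain, app, bSucc, vars]⟩
    · exact c.isTRS_rules p hp
  · cases n with
    | zero =>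
      refine .single (step_of_mem (Or.inl (Or.inl rfl)) (fun _ => .var 0) ?_ (subst_numeral _ _))
      rw [subst_appMain, subst_numeral]
      rfl
    | succ n =>
      refine .trans (.single (step_of_mem (Or.inl (Or.inr rfl)) (fun _ => numeral codeLang n)
        ?_ rfl)) ?_
      · rw [subst_appMain, subst_bSucc]
        rfl
      · have := Code.reflTransGen_app c (R := codeRules (f 0) c) Set.subset_union_right fun _ => n
        rwa [hc] at this

/-- Every function has defining rules, finitely many if it is primitive recursive, that are
compatible with all interpretations whose value at the main symbol is large enough. -/
theorem exists_defines (f : ℕ → ℕ) : ∃ R : Rules (baseLang codeLang),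
    Defines R CodeFun.main f ∧ (Nat.Primrec f → R.Finite) ∧
    ∃ B : ℕ → ℕ, PrimrecIn f (fun v : Fin 1 → ℕ => B (v 0)) ∧ ∀ φ : ℕ → ℕ, (∀ x, B x ≤ φ x) →
      Compatible (baseStructure φ) (fun x y : ℕ => x > y) R := by
  by_cases hf : Nat.Primrec f
  · obtain ⟨c, hc⟩ := Code.exists_eval_eq (Nat.Primrec'.prim_iff₁.2
      ((Primrec.nat_iff.2 hf).comp Primrec.succ))
    have hc' : ∀ v, c.eval v = f (v 0 + 1) := fun v => by
      have := hc (List.Vector.ofFn v)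
      rw [← List.Vector.get_zero, List.Vector.get_ofFn] at this
      rw [← this]
      congr 1
      ext i
      rw [List.Vector.get_ofFn]
    refine ⟨_, defines_codeRules hc', fun _ => finite_codeRules _ _,
      -- `f 0 + 1` beats the rule for argument 0; for `s(x)`, monotonicity gives `B (x + 1) >
      -- c.interp x`.
      fun x => c.interp (fun _ => x) + f 0 + 1, ?_, fun φ hφ => ?_⟩
    · exact (((c.primrecIn_interp f).comp fun _ => .proj 0).add (.const (f 0))).succ'
    · let _ := codeStructure φ
      rintro p ((rfl | rfl) | hp) α
      · have := hφ 0
        simp only [realize_numeral, realize_appMain]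
        simp only at this
        omega
      · have := hφ (α 0 + 1)
        have hle : c.interp (fun _ => α 0) ≤ c.interp fun _ => α 0 + 1 :=
          c.strictMono_interp.monotone fun _ => Nat.le_succ _
        have happ : (app c (vars 0 1)).realize α = c.interp fun _ => α 0 :=
          congrArg c.interp (funext fun i => by fin_cases i; rfl)
        simp only at this
        exact happ.trans_lt (show _ < φ (α 0 + 1) by omega)
      · exact c.compatible_rules φ p hp α
  · refine ⟨_, defines_tableRules f, fun h => absurd h hf, fun x => f x + 1,
      PrimrecIn.oracle.succ', ?_⟩
    rintro φ hφ _ ⟨n, rfl⟩ α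
    let _ := codeStructure φ
    simp only [realize_numeral, realize_appMain]
    exact hφ n

/-! ### The interpretation of the simulating system -/

/-- The interpretation of `g_i` as a function of its first argument and of the sum of all
arguments. -/
def giInterp (b : ℕ → ℕ) (d l C i x s : ℕ) : ℕ := (fast b (l + 2 * i))^[d ^ (x + 1) * (C + 1)] s

/-- The interpretation of `F(size(g_0(0, x_1, …, x_a)))` as a function of `x_1 + ⋯ + x_a`. -/
def sizeInterp (b : ℕ → ℕ) (d l C s : ℕ) : ℕ := fast b l (giInterp b d l C 0 0 s + 2)

/-- The interpretation of `g_i(F(size(g_0(0, x_1, …, x_a))), x_1, …, x_a)` as a function of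
`x_1 + ⋯ + x_a`. -/
def callInterp (b : ℕ → ℕ) (d l C i s : ℕ) : ℕ :=
  giInterp b d l C i (sizeInterp b d l C s) (sizeInterp b d l C s + s)

/-! ### Numerical inequalities behind the orientation of the rules -/

section Inequalities

variable {b : ℕ → ℕ} {d l C : ℕ}

theorem giInterp_le_giInterp (hb : Steep d b) (hd : 2 ≤ d) (i : ℕ) {x x' s s' : ℕ} (hx : x ≤ x')
    (hs : s ≤ s') : giInterp b d l C i x s ≤ giInterp b d l C i x' s' :=
  (hb.fast hd _).iterate_le_iterate hd
    (Nat.mul_le_mul_right _ (Nat.pow_le_pow_right (by omega) (by omega))) hs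

theorem giInterp_lt_giInterp (hb : Steep d b) (hd : 2 ≤ d) (i : ℕ) {x x' s s' : ℕ} (hx : x ≤ x')
    (hs : s < s') : giInterp b d l C i x s < giInterp b d l C i x' s' :=
  (hb.fast hd _).iterate_lt_iterate hd
    (Nat.mul_le_mul_right _ (Nat.pow_le_pow_right (by omega) (by omega))) hs

theorem callInterp_strictMono (hb : Steep d b) (hd : 2 ≤ d) (i : ℕ) :
    StrictMono (callInterp b d l C i) := by
  intro s s' hs
  have h : sizeInterp b d l C s ≤ sizeInterp b d l C s' :=
    (hb.fast hd l).strictMono.monotone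
      (Nat.add_le_add_right (giInterp_le_giInterp hb hd 0 le_rfl hs.le) 2)
  exact giInterp_lt_giInterp hb hd i h (by omega)

theorem le_pow_mul (d C x : ℕ) : d * (C + 1) ≤ d ^ (x + 1) * (C + 1) :=
  Nat.mul_le_mul_right _ (Nat.le_self_pow (by omega) d)

/-- Two applications of the function suffice for the sizes of the arguments. -/
theorem mul_add_lt_giInterp (hb : Steep d b) {a : ℕ} (hd : 2 ≤ d) (ha : a + 1 ≤ d) (i x : ℕ)
    {y s : ℕ} (hy : y ≤ s) : (a + 1) * (y + 2) + 1 ≤ giInterp b d l C i x s := by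
  have hF := hb.fast hd (l + 2 * i)
  have h₁ : (fast b (l + 2 * i))^[2] y ≤ giInterp b d l C i x s :=
    hF.iterate_le_iterate hd (by nlinarith [le_pow_mul d C x]) hy
  have h₂ := hF.mul_succ_le hd (fast b (l + 2 * i) y)
  have h₃ := hF.add_two_le hd y
  simp only [Function.iterate_succ, Function.iterate_zero, Function.comp_apply, id] at h₁
  nlinarith

theorem lt_giInterp (hb : Steep d b) (hd : 2 ≤ d) (i x s : ℕ) : s < giInterp b d l C i x s := by
  have := mul_add_lt_giInterp (l := l) (C := C) hb (a := 0) hd (by omega) i x (le_refl s)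
  omega

/-- The interpretations of the terms `M_i^j(x, x_1, …, x_a)`. -/
theorem iterated_lt_giInterp (hb : Steep d b) {a : ℕ} (hd : C + 2 ≤ d) (ha : a + 1 ≤ d)
    (i x s : ℕ) {M : ℕ → ℕ} (h0 : M 0 = giInterp b d l C i x (x + s))
    (hM : ∀ j, M (j + 1) = giInterp b d l C i x (x + a * M j)) :
    M C < giInterp b d l C i (x + 1) (x + 1 + s) := by
  have hd2 : 2 ≤ d := by omega
  have hF := hb.fast hd2 (l + 2 * i)
  set F := fast b (l + 2 * i) with hFdef
  set N := d ^ (x + 1) * (C + 1) with hN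
  have hx : ∀ j, x ≤ M j := by
    intro j
    cases j with
    | zero => rw [h0]; have := lt_giInterp (l := l) (C := C) hb hd2 i x (x + s); omega
    | succ j => rw [hM]; have := lt_giInterp (l := l) (C := C) hb hd2 i x (x + a * M j); omega
  have key : ∀ j, M j ≤ F^[(N + 1) * j + N] (x + s) := by
    intro j
    induction j with
    | zero => rw [h0, giInterp, Nat.mul_zero, Nat.zero_add]
    | succ j ih =>
      -- As `x ≤ M j` and `a + 1 ≤ d`, a single extra `F` absorbs the sum of the arguments.
      have h₁ : x + a * M j ≤ F (M j) := by
        have := hF.mul_succ_le hd2 (M j)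
        have := hx j
        nlinarith
      calc M (j + 1) = F^[N] (x + a * M j) := hM j
        _ ≤ F^[N] (F (M j)) := hF.iterate_le_iterate hd2 le_rfl h₁
        _ = F^[N + 1] (M j) := (Function.iterate_succ_apply F N _).symm
        _ ≤ F^[N + 1] (F^[(N + 1) * j + N] (x + s)) := hF.iterate_le_iterate hd2 le_rfl ih
        _ = F^[(N + 1) * (j + 1) + N] (x + s) := by
          rw [← Function.iterate_add_apply]; congr 1; ring
  -- Strictness comes from the starting point `x + s < x + 1 + s`; for the exponents, `(N + 1) * C +
  -- N ≤ N * (C + 2) ≤ d * N` because `C ≤ N`.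
  refine (key C).trans_lt (hF.iterate_lt_iterate hd2 ?_ (by omega))
  have h₁ : d ^ (x + 1 + 1) * (C + 1) = d * N := by rw [hN]; ring
  have h₂ : C ≤ N := by nlinarith [le_pow_mul d C x]
  rw [h₁]
  nlinarith

/-- With `p = l + 2i`, the counter `y` is at most `D + 2` iterates of `F_p` at `s`. The iteration
count is exponential in `y`, hence below `w = F_p (y + 1)`, and the whole call collapses to `F_{p+1}
w`. As `w` is itself boundedly many iterates of `F_p`, it lies below `F_{p+1} v` for moderate `v`,
and `F_{p+2} v` covers both applications of `F_{p+1}`. -/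
theorem callInterp_lt_giInterp (hb : Steep d b) (hd : C + 2 ≤ d) (hd3 : 3 ≤ d) (i x s : ℕ) :
    callInterp b d l C i s < giInterp b d l C (i + 1) x (x + s) := by
  have hd2 : 2 ≤ d := by omega
  set p := l + 2 * i with hp
  set D := d ^ (0 + 1) * (C + 1) with hD
  have hDd : D = d * (C + 1) := by rw [hD]; ring
  have hF := hb.fast hd2 p
  have hF₁ := hb.fast hd2 (p + 1)
  have hF₂ := hb.fast hd2 (p + 2)
  have h12 : ∀ m, fast b (p + 1) m ≤ fast b (p + 2) m := fast_le_fast hb hd2 (by omega)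
  set y := sizeInterp b d l C s with hy
  have hys : s ≤ y := by
    have h₁ := lt_giInterp (l := l) (C := C) hb hd2 0 0 s
    have h₂ := (hb.fast hd2 l).add_two_le hd2 (giInterp b d l C 0 0 s + 2)
    rw [hy, sizeInterp]
    omega
  have hyp : y ≤ (fast b p)^[D + 2] s := by
    have h₁ : giInterp b d l C 0 0 s ≤ (fast b p)^[D] s :=
      (hb.fast hd2 l).strictMono.monotone.iterate_le_of_le (fast_le_fast hb hd2 (by omega)) D s
    have h₂ := hF.add_two_le hd2 ((fast b p)^[D] s)
    rw [Nat.add_comm D 2, Function.iterate_add_apply]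
    exact (fast_le_fast hb hd2 (n' := p) (by omega) _).trans
      (hF.strictMono.monotone (show _ ≤ fast b p _ by omega))
  have hw : fast b p (y + 1) ≤ (fast b p)^[D + 4] s := by
    have h₂ := hF.add_two_le hd2 y
    rw [show D + 4 = 2 + (D + 2) by ring, Function.iterate_add_apply]
    exact (hF.strictMono.monotone (show _ ≤ fast b p y by omega)).trans
      (hF.iterate_le_iterate hd2 (n := 2) le_rfl hyp)
  set w := fast b p (y + 1) with hwdef
  have hcall : callInterp b d l C i s ≤ fast b (p + 1) w := by
    refine hF.iterate_le_iterate hd2 ?_ ?_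
    -- Here the growth of the base function is used: `d ^ (y + 1) * (C + 1) ≤ d ^ (y + 2) ≤ w`.
    · have h₁ := hF.pow_le (y + 1)
      have h₂ : d ^ (y + 1) * (C + 1) ≤ d ^ (y + 1) * d := Nat.mul_le_mul_left _ (by omega)
      rw [← pow_succ] at h₂
      exact (h₂.trans h₁).trans (Nat.le_succ w)
    · have h₁ := hF.mul_succ_le hd2 (y + 1)
      nlinarith
  set u := fast b (p + 2) s with hu
  set v := fast b (p + 2) u with hv
  have hud : d ≤ u := (Nat.le_self_pow (by omega) d).trans (hF₂.pow_le s)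
  have hsu := hF₂.add_two_le hd2 s
  have huv := hF₂.add_two_le hd2 u
  -- `v ≥ d * (u + 1) ≥ d * (d + 1)`, while `D = d * (C + 1) ≤ d * (d - 1)`.
  have hDv : D + 4 ≤ v + 1 := by
    have h₁ := hF₂.mul_succ_le hd2 u
    nlinarith
  have hwv : w < fast b (p + 1) v :=
    hw.trans_lt (hF.iterate_lt_iterate hd2 hDv (by omega))
  calc callInterp b d l C i s ≤ fast b (p + 1) w := hcall
    _ < fast b (p + 1) (fast b (p + 1) v) := hF₁.strictMono hwv
    _ ≤ fast b (p + 2) v := hF₁.iterate_le_iterate hd2 (n := 2) (by omega) le_rfl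
    _ = (fast b (p + 2))^[3] s := rfl
    -- Three iterations are available because `d * (C + 1) ≥ 3`.
    _ ≤ giInterp b d l C (i + 1) x (x + s) :=
      hF₂.iterate_le_iterate hd2 (by nlinarith [le_pow_mul d C x]) (by omega)

end Inequalities

/-- The interpretation of the symbols of the simulating system. -/
abbrev ownStructure (b : ℕ → ℕ) (d l a C k : ℕ) : (ownLang a k).Structure ℕ where
  funMap
    | .gi i, v => giInterp b d l C i (v 0) (∑ j, v j)
    | .size, v => v 0 + 2
    | .d, v => (a + 1) * v 0 + 1
    | .g, v => callInterp b d l C k (a * v 0) + v 0 + 1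
    | .c, _ => 0
    | .z, _ => callInterp b d l C k 0 + 1
  RelMap r := r.elim

/-- The interpretation of the simulating system. -/
abbrev simStructure (b : ℕ → ℕ) (d l a C k : ℕ) : (simLang codeLang a k).Structure ℕ :=
  letI := codeStructure (fast b l)
  letI := ownStructure b d l a C k
  inferInstance

/-! ### Monotonicity, relative primitive recursiveness and compatibility of the interpretation -/

section Structure

variable {b : ℕ → ℕ} {d l a C k : ℕ}

theorem strictMono_funMap (hb : Steep d b) (hd : 2 ≤ d) (n : ℕ)
    (h : (simLang codeLang a k).Functions n) :
    StrictMono fun v : Fin n → ℕ => (simStructure b d l a C k).funMap h v := by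
  have hone : ∀ {v w : Fin 1 → ℕ}, v < w → v 0 < w 0 := fun h => by
    simpa using Code.strictMono_sum 1 h
  have hzero : ∀ {v w : Fin 0 → ℕ}, ¬ v < w := fun h => h.ne (Subsingleton.elim _ _)
  intro v w hvw
  rcases h with (h | h) | h
  · cases h with
    | zero => exact absurd hvw hzero
    | succ => exact Nat.succ_lt_succ (hone hvw)
  · cases h with
    | main => exact (hb.fast hd l).strictMono (hone hvw)
    | code c => exact c.strictMono_interp hvw
  · cases h with
    | gi i => exact giInterp_lt_giInterp hb hd i (hvw.le 0) (Code.strictMono_sum _ hvw)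
    | size => exact Nat.add_lt_add_right (hone hvw) 2
    | d => exact Nat.succ_lt_succ (Nat.mul_lt_mul_of_pos_left (hone hvw) (Nat.succ_pos a))
    -- The separate summand `v 0` gives strictness, since for `a = 0` the first summand is constant.
    | g =>
      have h := hone hvw
      have := (callInterp_strictMono (l := l) (C := C) hb hd k).monotone
        (Nat.mul_le_mul_left a h.le)
      change callInterp b d l C k (a * v 0) + v 0 + 1 < callInterp b d l C k (a * w 0) + w 0 + 1
      omega
    | c => exact absurd hvw hzero
    | z => exact absurd hvw hzero

theorem primrecIn_giInterp {f : ℕ → ℕ} (hb : PrimrecIn f fun v : Fin 1 → ℕ => b (v 0)) (i : ℕ)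
    {n : ℕ} {x s : (Fin n → ℕ) → ℕ} (hx : PrimrecIn f x) (hs : PrimrecIn f s) :
    PrimrecIn f fun v => giInterp b d l C i (x v) (s v) :=
  .iterate (hb.fast _) (((PrimrecIn.const d).pow hx.succ').mul (.const (C + 1))) hs

theorem primrecIn_callInterp {f : ℕ → ℕ} (hb : PrimrecIn f fun v : Fin 1 → ℕ => b (v 0)) (i : ℕ)
    {n : ℕ} {s : (Fin n → ℕ) → ℕ} (hs : PrimrecIn f s) :
    PrimrecIn f fun v => callInterp b d l C i (s v) := by
  have h : PrimrecIn f fun v => sizeInterp b d l C (s v) :=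
    PrimrecIn.comp₁ (g := fast b l) (hb.fast l) ((primrecIn_giInterp hb 0 (.const 0) hs).add (.const 2))
  exact primrecIn_giInterp hb i h (h.add hs)

theorem primrecIn_funMap {f : ℕ → ℕ} (hb : PrimrecIn f fun v : Fin 1 → ℕ => b (v 0)) (n : ℕ)
    (h : (simLang codeLang a k).Functions n) :
    PrimrecIn f fun v : Fin n → ℕ => (simStructure b d l a C k).funMap h v := by
  rcases h with (h | h) | h
  · cases h with
    | zero => exact .zero 0
    | succ => exact .succ
  · cases h with
    | main => exact hb.fast l
    | code c => exact c.primrecIn_interp f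
  · cases h with
    | gi i => exact primrecIn_giInterp hb i (.proj 0) .sum_proj
    | size => exact (PrimrecIn.proj 0).add (.const 2)
    | d => exact ((PrimrecIn.const (a + 1)).mul (.proj 0)).succ'
    | g =>
      exact ((primrecIn_callInterp hb k ((PrimrecIn.const a).mul (.proj 0))).add (.proj 0)).succ'
    | c => exact .zero 0
    | z => exact .const _

variable (b d l C) in
/-- The value of a term of the simulating system. -/
def val (α : ℕ → ℕ) (t : (simLang codeLang a k).Term ℕ) : ℕ :=
  letI := simStructure b d l a C k
  t.realize α

variable (α : ℕ → ℕ)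

theorem val_tZero : val b d l C α (tZero codeLang a k) = 0 := rfl

theorem val_tC : val b d l C α (tC codeLang a k) = 0 := rfl

theorem val_tZ : val b d l C α (tZ codeLang a k) = callInterp b d l C k 0 + 1 := rfl

variable (t : (simLang codeLang a k).Term ℕ)

theorem val_tSucc : val b d l C α (tSucc t) = val b d l C α t + 1 := rfl

theorem val_iterate_tSucc (n : ℕ) : val b d l C α (tSucc^[n] t) = val b d l C α t + n := by
  induction n with
  | zero => rfl
  | succ n ih => rw [Function.iterate_succ_apply', val_tSucc, ih, Nat.add_assoc]

theorem val_tSize : val b d l C α (tSize t) = val b d l C α t + 2 := rfl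

theorem val_tD : val b d l C α (tD t) = (a + 1) * val b d l C α t + 1 := rfl

theorem val_tG : val b d l C α (tG t) =
    callInterp b d l C k (a * val b d l C α t) + val b d l C α t + 1 := rfl

theorem val_tExt_main : val b d l C α (tExt CodeFun.main t) = fast b l (val b d l C α t) := rfl

theorem val_tGi (i : Fin (k + 1)) (ts : Fin a → (simLang codeLang a k).Term ℕ) :
    val b d l C α (tGi i t ts) = giInterp b d l C i (val b d l C α t)
      (val b d l C α t + ∑ j, val b d l C α (ts j)) := by
  change giInterp b d l C i _ (∑ j, val b d l C α ((Fin.cons t ts : Fin (a + 1) → _) j)) = _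
  rw [Fin.sum_univ_succ]
  rfl

theorem val_call (i : Fin (k + 1)) (ts : Fin a → (simLang codeLang a k).Term ℕ) :
    val b d l C α (tGi i (tExt CodeFun.main (tSize (tGi 0 (tZero codeLang a k) ts))) ts) =
      callInterp b d l C i (∑ j, val b d l C α (ts j)) := by
  simp only [val_tGi, val_tExt_main, val_tSize, val_tZero, Nat.zero_add]
  rfl

/-- Rules `r1`, `r2`, `r3` are the three inequalities on `giInterp`. The factor `a + 1` for `d_a`
pays for the `a` successors in `r5`, and `g` and `z` are interpreted to exceed their right-hand
sides. -/
theorem compatible_ownRule (hb : Steep d b) (hC : C + 2 ≤ d) (ha : a + 1 ≤ d) (hd : 3 ≤ d)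
    {p : (simLang codeLang a k).Term ℕ × (simLang codeLang a k).Term ℕ}
    (hp : OwnRule codeLang CodeFun.main a C k p) : val b d l C α p.2 < val b d l C α p.1 := by
  have hd2 : 2 ≤ d := by omega
  have hsum : ∀ j : Fin a, val b d l C α (vxs codeLang a k j) ≤
      ∑ j, val b d l C α (vxs codeLang a k j) := fun j =>
    Finset.single_le_sum (f := fun j => val b d l C α (vxs codeLang a k j))
      (fun _ _ => Nat.zero_le _) (Finset.mem_univ j)
  cases hp with
  | r1 i =>
    simp only [val_tGi, val_tSucc]
    refine iterated_lt_giInterp hb hC ha i _ _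
      (M := fun j => val b d l C α (tM i (vx codeLang a k) (vxs codeLang a k) j)) ?_ fun j => ?_
    · exact val_tGi α _ i _
    · simp only [tM, val_tGi, Finset.sum_const, Finset.card_univ, Fintype.card_fin, smul_eq_mul]
  | r2 i =>
    simp only [val_call]
    rw [val_tGi]
    exact callInterp_lt_giInterp hb hC hd i _ _
  | r3 i j =>
    simp only [val_tGi, val_tSize, val_tD]
    have := mul_add_lt_giInterp (l := l) (C := C) hb hd2 ha i (val b d l C α (vx codeLang a k))
      ((hsum j).trans (Nat.le_add_left _ (val b d l C α (vx codeLang a k))))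
    omega
  | r4 =>
    simp only [val_tSize, val_tC, val_tSucc, val_tZero]
    omega
  | r5 =>
    simp only [val_tD, val_iterate_tSucc, val_tSucc, Nat.mul_succ]
    omega
  | r6 =>
    simp only [val_tD, val_tZero]
    omega
  | r7 =>
    simp only [val_tGi, val_tC]
    exact (Nat.zero_le _).trans_lt (lt_giInterp hb hd2 _ _ _)
  | r8 i j =>
    simp only [val_tGi]
    exact ((hsum j).trans (Nat.le_add_left _ _)).trans_lt (lt_giInterp hb hd2 _ _ _)
  | r9 =>
    simp only [val_call, val_tG, Finset.sum_const, Finset.card_univ, Fintype.card_fin,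
      smul_eq_mul, Fin.val_last]
    omega
  | r10 =>
    simp only [val_call, val_tZ, val_tC, Finset.sum_const_zero, Fin.val_last]
    omega

theorem compatible_simRules (hb : Steep d b) (hC : C + 2 ≤ d) (ha : a + 1 ≤ d) (hd : 3 ≤ d)
    {R : Rules (baseLang codeLang)}
    (hR : Compatible (baseStructure (fast b l)) (fun x y : ℕ => x > y) R) :
    Compatible (simStructure b d l a C k) (fun x y : ℕ => x > y)
      (simRules R CodeFun.main a C k) := by
  rintro _ (hp | ⟨p, hp, rfl⟩) α
  · exact compatible_ownRule α hb hC ha hd hp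
  · let _ := codeStructure (fast b l)
    let _ := ownStructure b d l a C k
    simpa only [FirstOrder.Language.LHom.realize_onTerm] using hR p hp α

end Structure

/-! ### Choice of the base function and of the level -/

theorem steep_pow {d : ℕ} (hd : 2 ≤ d) : Steep d fun m => d ^ (m + 1) :=
  ⟨fun _ _ h => Nat.pow_lt_pow_right (by omega) (by omega), fun _ => le_rfl⟩

/-- Every bound is dominated by a level of a suitable hierarchy. -/
theorem exists_fast_bound {f B : ℕ → ℕ} (hB : PrimrecIn f fun v : Fin 1 → ℕ => B (v 0)) {d : ℕ}
    (hd : 2 ≤ d) (hd0 : B 0 ≤ d) : ∃ (l : ℕ) (b : ℕ → ℕ), Steep d b ∧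
      PrimrecIn f (fun v : Fin 1 → ℕ => b (v 0)) ∧ (Nat.Primrec f → ∀ m, b m = d ^ (m + 1)) ∧
      ∀ x, B x ≤ fast b l x := by
  have hpow : PrimrecIn f fun v : Fin 1 → ℕ => d ^ (v 0 + 1) :=
    (PrimrecIn.const d).pow (PrimrecIn.proj 0).succ'
  by_cases hf : Nat.Primrec f
  · obtain ⟨l, hl⟩ := exists_lt_ack_of_nat_primrec (hB.nat_primrec hf)
    refine ⟨l, _, steep_pow hd, hpow, fun _ _ => rfl, fun x => ?_⟩
    -- The comparison with Ackermann's function says nothing at 0; there `B 0 ≤ d` takes over.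
    rcases Nat.eq_zero_or_pos x with rfl | hx
    · have := ((steep_pow hd).fast hd l).pow_le 0
      rw [Nat.zero_add, pow_one] at this
      omega
    · exact (hl x).le.trans (ack_le_fast (steep_pow hd) hd l hx)
  -- The partial sums of `B` are monotone and dominate `B`, so level 0 already suffices.
  · refine ⟨0, fun m => d ^ (m + 1) + ∑ i ∈ Finset.range (m + 1), B i, ⟨fun m m' h => ?_,
      fun m => Nat.le_add_right _ _⟩, hpow.add ?_, fun h => absurd h hf, fun x => ?_⟩
    · exact Nat.add_lt_add_of_lt_of_le ((steep_pow hd).strictMono h)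
        (Finset.sum_le_sum_of_subset (Finset.range_mono (by omega)))
    · exact .comp₁ (g := fun m => ∑ i ∈ Finset.range m, B i) hB.sum_range (PrimrecIn.proj 0).succ'
    · have := Finset.single_le_sum (f := B) (fun _ _ => Nat.zero_le _)
        (Finset.self_mem_range_succ x)
      simp only [fast]
      omega

end SimTRS

theorem propositionp (f : ℕ → ℕ) :
    ∃ (G : FirstOrder.Language.{0, 0}) (F : G.Functions 1)
      (R : SimTRS.Rules (SimTRS.baseLang G)),
      SimTRS.Defines R F f ∧ (Nat.Primrec f → R.Finite) ∧
      ∀ a C k : ℕ,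
        (∃ I : (SimTRS.simLang G a k).Structure ℕ,
          SimTRS.IsWellFoundedMonotone I (fun x y : ℕ => x > y) ∧
          SimTRS.Compatible I (fun x y : ℕ => x > y) (SimTRS.simRules R F a C k) ∧
          (∀ (n : ℕ) (g : (SimTRS.simLang G a k).Functions n),
            SimTRS.PrimrecIn f (fun v : Fin n → ℕ => I.funMap g v)) ∧
          ∃ (d l : ℕ) (b : ℕ → ℕ), max (C + 2) (a + 1) ≤ d ∧
            SimTRS.PrimrecIn f (fun v : Fin 1 → ℕ => b (v 0)) ∧
            (Nat.Primrec f → ∀ m, b m = d ^ (m + 1)) ∧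
            (∀ x : ℕ, I.funMap (SimTRS.extSym a k F) ![x] = SimTRS.fast b l x) ∧
            (∀ (i : Fin (k + 1)) (x : ℕ) (xs : Fin a → ℕ),
              I.funMap (SimTRS.giSym G a k i) (Fin.cons x xs) =
                (SimTRS.fast b (l + 2 * (i : ℕ)))^[d ^ (x + 1) * (C + 1)]
                  (x + ∑ j, xs j))) ∧
        SimTRS.Terminating (SimTRS.simRules R F a C k) := by
  obtain ⟨R, hR, hfin, B, hB, hcomp⟩ := SimTRS.exists_defines f
  refine ⟨SimTRS.codeLang, SimTRS.CodeFun.main, R, hR, hfin, fun a C k => ?_⟩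
  -- This `d` exceeds `C + 2` and `a + 1`, is at least 3 and bounds `B 0`; neither the rules nor `B`
  -- depend on `a`, `C`, `k`.
  obtain ⟨l, b, hb, hbf, hpow, hle⟩ :=
    SimTRS.exists_fast_bound (d := C + a + B 0 + 3) hB (by omega) (by omega)
  have hI := SimTRS.isWellFoundedMonotone_of_strictMono
    (SimTRS.strictMono_funMap (l := l) (a := a) (C := C) (k := k) hb (by omega))
  have hc := SimTRS.compatible_simRules (k := k) hb (C := C) (a := a) (by omega) (by omega)
    (by omega) (hcomp _ hle)
  refine ⟨⟨_, hI, hc, SimTRS.primrecIn_funMap hbf, _, l, b, ?_, hbf, hpow, fun x => rfl,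
    fun i x xs => ?_⟩, SimTRS.terminating_of_compatible hI hc⟩
  · exact max_le (by omega) (by omega)
  · change SimTRS.giInterp b _ l C i x (∑ j, (Fin.cons x xs : Fin (a + 1) → ℕ) j) = _
    rw [Fin.sum_cons]
    rfl
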